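/- Let $\Bbbk$ be a field, let $n\ge 0$, let $L\subset\mathbb{Z}^n$ be a lattice (an additive subgroup), and let $I_L=\langle x^u-x^v : u,v\in\mathbb{N}^n,\ u-v\in L\rangle\subset \Bbbk[x_1,\dots,x_n]$ be its lattice ideal. *Definitions.* A binomial is a difference $x^u-x^v$ of two monomials. Let $\mu(I_L)$ be the least cardinality of a minimal (with respect to inclusion) generating set of $I_L$ consisting of binomials; a Markov basis of $I_L$ is such a minimal generating set of least cardinality. Let $L^+=L\cap\mathbb{N}^n$, let $L_{pure}$ be the subgroup of $L$ generated by $L^+$, and let $\sigma=\{i : w_i\neq 0 \text{ for some } w\in L^+\}$. For $u\in\mathbb{Z}^n$ put $u^\sigma=(u_i)_{i\notin\sigma}$. The fiber of $x^u$ is the set of monomials $F_u=\{x^v : v-u\in L\}$; an $I_L$-fiber is a set of this form. For a binomial $0\ne B=x^u-x^v\in I_L$ put $F_B=F_u=F_v$. Two $I_L$-fibers $F,G$ are equivalent if $x^aF\subset G$ and $x^bG\subset F$ for some $a,b\in\mathbb{N}^n$; $\overline F$ denotes the equivalence class of $F$. The classes are partially ordered by $\overline F\le\overline G$ if and only if $x^aF\subset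 G$ for some $a\in\mathbb{N}^n$. An $I_L$-fiber $F$ is a Markov fiber if $\overline F=\overline{F_B}$ for some element $B$ of some Markov basis of $I_L$. Let $F_{\{1\}}$ be the fiber of the monomial $1$. For an $I_L$-fiber $F$ let $I_{<\overline F}$ be the ideal generated by the binomials $B\in I_L$ with $\overline{F_B}<\overline F$, let $M_F$ be the monomial ideal generated by $F$, and let $G(M_F)$ be its minimal set of monomial generators. Let $G_{\overline F}$ be the graph with vertex set $\{a^\sigma : x^a\in G(M_F)\}$ in which two distinct vertices $p,q$ are joined if and only if there are $x^u,x^v\in F$ with $u^\sigma=p$, $v^\sigma=q$ and $x^u-x^v\in I_{<\overline F}$. Let $\Gamma_{\overline F}$ be the complete graph whose vertices are the connected components of $G_{\overline F}$, and let $t(\overline F)$ be its number of vertices; it depends only on the class $\overline F$. **Theorem.** The ideal $I_L$ has a finite Markov basis, there are only finitely many equivalence classes of Markov fibers, and $$\mu(I_L)=\operatorname{rank}(L_{pure})+\sum_{\overline F\neq\overline F_{\{1\}}}\bigl(t(\overline F)-1\bigr),$$ where the sum runs over all distinct equivalence classes $\overline F$ of Markov fibers other than $\overline F_{\{1\}}$.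 In particular every $t(\overline F)$ in the sum is finite. -/

import Mathlib

/-! A lattice is an additive subgroup `L` of `ℤⁿ = Fin n → ℤ`. The monomial `x^u` of
`k[x₁, …, xₙ]` is `MvPolynomial.monomial u 1`, and sets of monomials are written as sets of
exponent vectors in `Fin n →₀ ℕ`. -/

namespace LatticeIdeal

open MvPolynomial

noncomputable section

/-- An exponent vector in `ℕⁿ`, viewed in `ℤⁿ`. -/
def toInt {n : ℕ} (u : Fin n →₀ ℕ) : Fin n → ℤ := fun i => (u i : ℤ)

/-- The monomial `x^u`. -/
def mono (k : Type*) [Field k] {n : ℕ} (u : Fin n →₀ ℕ) : MvPolynomial (Fin n) k :=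
  monomial u 1

/-- The lattice ideal `I_L = ⟨x^u - x^v : u - v ∈ L⟩`. -/
def latticeIdeal (k : Type*) [Field k] {n : ℕ} (L : AddSubgroup (Fin n → ℤ)) :
    Ideal (MvPolynomial (Fin n) k) :=
  Ideal.span {p | ∃ u v : Fin n →₀ ℕ, toInt u - toInt v ∈ L ∧ p = mono k u - mono k v}

/-- `L⁺ = L ∩ ℕⁿ`. -/
def posPart {n : ℕ} (L : AddSubgroup (Fin n → ℤ)) : Set (Fin n → ℤ) := {w | w ∈ L ∧ 0 ≤ w}

/-- `L_pure`, the subgroup generated by `L⁺`. -/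
def pureSublattice {n : ℕ} (L : AddSubgroup (Fin n → ℤ)) : AddSubgroup (Fin n → ℤ) :=
  AddSubgroup.closure (posPart L)

/-- `σ_L`, the union of the supports of the elements of `L⁺`. -/
def sigma {n : ℕ} (L : AddSubgroup (Fin n → ℤ)) : Set (Fin n) := {i | ∃ w ∈ posPart L, w i ≠ 0}

/-- `u^σ = (u_i)_{i ∉ σ}`. -/
def outside {n : ℕ} (L : AddSubgroup (Fin n → ℤ)) (u : Fin n →₀ ℕ) : {i // i ∉ sigma L} → ℕ :=
  fun i => u i

/-! ### Binomial generating sets -/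

/-- Binomials are differences of two monomials. -/
def IsBinomial {k : Type*} [Field k] {n : ℕ} (p : MvPolynomial (Fin n) k) : Prop :=
  ∃ u v : Fin n →₀ ℕ, p = mono k u - mono k v

/-- `S` consists of binomials, generates `I_L`, and no proper subset of `S` generates `I_L`. -/
def IsMinimalGenSet (k : Type*) [Field k] {n : ℕ} (L : AddSubgroup (Fin n → ℤ))
    (S : Set (MvPolynomial (Fin n) k)) : Prop :=
  (∀ p ∈ S, IsBinomial p) ∧ Ideal.span S = latticeIdeal k L ∧
    ∀ T, T ⊂ S → Ideal.span T ≠ latticeIdeal k L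

/-- `μ(I_L)`, the least cardinality of a minimal generating set of `I_L` consisting of
binomials. -/
def mu (k : Type*) [Field k] {n : ℕ} (L : AddSubgroup (Fin n → ℤ)) : ℕ :=
  sInf {m : ℕ | ∃ S : Set (MvPolynomial (Fin n) k), IsMinimalGenSet k L S ∧ S.encard = m}

/-- A Markov basis is a minimal binomial generating set of least cardinality. -/
def IsMarkovBasis (k : Type*) [Field k] {n : ℕ} (L : AddSubgroup (Fin n → ℤ))
    (S : Set (MvPolynomial (Fin n) k)) : Prop :=
  IsMinimalGenSet k L S ∧ ∀ T, IsMinimalGenSet k L T → S.encard ≤ T.encard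

/-! ### Fibers and their equivalence classes -/

/-- The set of (exponents of) monomials `x^v` with `v - u ∈ L`. -/
def fiberSet {n : ℕ} (L : AddSubgroup (Fin n → ℤ)) (u : Fin n →₀ ℕ) : Set (Fin n →₀ ℕ) :=
  {v | toInt v - toInt u ∈ L}

/-- The type of `I_L`-fibers. -/
def Fiber {n : ℕ} (L : AddSubgroup (Fin n → ℤ)) : Type :=
  {F : Set (Fin n →₀ ℕ) // ∃ u, F = fiberSet L u}

/-- The fiber `F_u` of `x^u`. -/
def Fiber.of {n : ℕ} (L : AddSubgroup (Fin n → ℤ)) (u : Fin n →₀ ℕ) : Fiber L :=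
  ⟨fiberSet L u, u, rfl⟩

/-- `F ≤ G` if and only if `x^u F ⊆ G` for some monomial `x^u`. -/
instance {n : ℕ} (L : AddSubgroup (Fin n → ℤ)) : Preorder (Fiber L) where
  le F G := ∃ u : Fin n →₀ ℕ, ∀ v ∈ F.1, u + v ∈ G.1
  le_refl F := ⟨0, fun v hv => by simpa using hv⟩
  le_trans F G H := by
    rintro ⟨u, hu⟩ ⟨w, hw⟩
    exact ⟨w + u, fun v hv => by rw [add_assoc]; exact hw _ (hu _ hv)⟩

/-- Equivalence classes of fibers, where `F ≡ G` if and only if `x^u F ⊆ G` and `x^v G ⊆ F` for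
some `u, v`. They are partially ordered by `F̄ ≤ Ḡ` if and only if `x^u F ⊆ G` for some `u`. -/
abbrev FiberClass {n : ℕ} (L : AddSubgroup (Fin n → ℤ)) : Type :=
  Antisymmetrization (Fiber L) (· ≤ ·)

/-- The equivalence class of a fiber. -/
def Fiber.cls {n : ℕ} {L : AddSubgroup (Fin n → ℤ)} (F : Fiber L) : FiberClass L :=
  toAntisymmetrization (· ≤ ·) F

/-- The class of the fiber of the monomial `1`. -/
def oneClass {n : ℕ} (L : AddSubgroup (Fin n → ℤ)) : FiberClass L := (Fiber.of L 0).cls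

/-- A fiber `F` is a Markov fiber if `F̄ = F̄_B` for some element `B = x^u - x^v` of some Markov
basis; here `F_B = F_u`. -/
def IsMarkovFiber (k : Type*) [Field k] {n : ℕ} {L : AddSubgroup (Fin n → ℤ)}
    (F : Fiber L) : Prop :=
  ∃ S : Set (MvPolynomial (Fin n) k), IsMarkovBasis k L S ∧
    ∃ u v : Fin n →₀ ℕ, mono k u - mono k v ∈ S ∧ F.cls = (Fiber.of L u).cls

/-- The set of equivalence classes of Markov fibers. -/
def markovClasses (k : Type*) [Field k] {n : ℕ} (L : AddSubgroup (Fin n → ℤ)) :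
    Set (FiberClass L) :=
  {c | ∃ F : Fiber L, IsMarkovFiber k F ∧ F.cls = c}

/-! ### The graphs -/

/-- `I_{<F̄}`, generated by the binomials `B ∈ I_L` with `F̄_B < F̄`. -/
def idealLT (k : Type*) [Field k] {n : ℕ} {L : AddSubgroup (Fin n → ℤ)} (c : FiberClass L) :
    Ideal (MvPolynomial (Fin n) k) :=
  Ideal.span {p | p ∈ latticeIdeal k L ∧
    ∃ u v : Fin n →₀ ℕ, p = mono k u - mono k v ∧ (Fiber.of L u).cls < c}

/-- The monomial ideal `M_F` generated by the elements of `F`. -/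
def fiberIdeal (k : Type*) [Field k] {n : ℕ} {L : AddSubgroup (Fin n → ℤ)} (F : Fiber L) :
    Ideal (MvPolynomial (Fin n) k) :=
  Ideal.span ((fun u => mono k u) '' F.1)

/-- The (exponents of the) minimal monomial generators of a monomial ideal: the monomials of the
ideal that are minimal for divisibility. -/
def minGens {k : Type*} [Field k] {n : ℕ} (J : Ideal (MvPolynomial (Fin n) k)) :
    Set (Fin n →₀ ℕ) :=
  {u | Minimal (fun v => mono k v ∈ J) u}

/-- The vertex set `G(M_F)^σ`. -/
def vertexSet (k : Type*) [Field k] {n : ℕ} {L : AddSubgroup (Fin n → ℤ)} (F : Fiber L) :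
    Set ({i // i ∉ sigma L} → ℕ) :=
  outside L '' minGens (fiberIdeal k F)

/-- `a` and `b` are joined when `a = u^σ`, `b = v^σ` with `x^u, x^v ∈ F` and
`x^u - x^v ∈ I_{<F̄}`. -/
def edgeGraph (k : Type*) [Field k] {n : ℕ} {L : AddSubgroup (Fin n → ℤ)} (F : Fiber L) :
    SimpleGraph ({i // i ∉ sigma L} → ℕ) where
  Adj a b := a ≠ b ∧ ∃ u ∈ F.1, ∃ v ∈ F.1, outside L u = a ∧ outside L v = b ∧
    mono k u - mono k v ∈ idealLT k F.cls
  symm := ⟨by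
    rintro a b ⟨hab, u, hu, v, hv, h1, h2, h⟩
    refine ⟨hab.symm, v, hv, u, hu, h2, h1, ?_⟩
    rw [← neg_sub]
    exact neg_mem h⟩
  loopless := ⟨fun a h => h.1 rfl⟩

/-- The graph `G_F̄` on the vertex set `G(M_F)^σ`. -/
def graphG (k : Type*) [Field k] {n : ℕ} {L : AddSubgroup (Fin n → ℤ)} (F : Fiber L) :
    SimpleGraph (vertexSet k F) :=
  (edgeGraph k F).induce (vertexSet k F)

/-- The vertices of `Γ_F̄` (a complete graph): the connected components of `G_F̄`. -/
abbrev GammaVertex (k : Type*) [Field k] {n : ℕ} {L : AddSubgroup (Fin n → ℤ)} (F : Fiber L) :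
    Type :=
  (graphG k F).ConnectedComponent

/-! The next facts show that the number of vertices of `Γ_F̄` depends only on the class of `F`. -/

theorem outside_eq_of_add {n : ℕ} {L : AddSubgroup (Fin n → ℤ)} {a b : Fin n →₀ ℕ}
    (h : toInt (a + b) ∈ L) (v : Fin n →₀ ℕ) : outside L (a + v) = outside L v := by
  funext i
  have hi : (a + b) i.1 = 0 := by
    by_contra hne
    refine i.2 ⟨toInt (a + b), ⟨h, fun j => ?_⟩, ?_⟩
    · simp [toInt]; positivity
    · simp only [toInt]; exact_mod_cast hne
  simp only [outside, Finsupp.add_apply] at hi ⊢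
  omega

theorem sub_mem_of_mem {n : ℕ} {L : AddSubgroup (Fin n → ℤ)} (F : Fiber L) {u v : Fin n →₀ ℕ}
    (hu : u ∈ F.1) (hv : v ∈ F.1) : toInt v - toInt u ∈ L := by
  obtain ⟨F, w, rfl⟩ := F
  have h := L.sub_mem hv hu
  simpa using h

theorem toInt_add {n : ℕ} (u v : Fin n →₀ ℕ) : toInt (u + v) = toInt u + toInt v := by
  funext i; simp [toInt]

theorem mono_mem_fiberIdeal (k : Type*) [Field k] {n : ℕ} {L : AddSubgroup (Fin n → ℤ)}
    (F : Fiber L) (u : Fin n →₀ ℕ) : mono k u ∈ fiberIdeal k F ↔ ∃ v ∈ F.1, v ≤ u := by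
  classical
  have h := mem_ideal_span_monomial_image (R := k) (x := mono k u) (s := F.1)
  simp only [fiberIdeal, mono] at h ⊢
  rw [h]
  simp [support_monomial]

theorem vertexSet_eq (k : Type*) [Field k] {n : ℕ} {L : AddSubgroup (Fin n → ℤ)} (F : Fiber L) :
    vertexSet k F = outside L '' F.1 := by
  have key : ∀ u, u ∈ minGens (fiberIdeal k F) → u ∈ F.1 := by
    intro u hu
    have hu : Minimal (fun v => mono k v ∈ fiberIdeal k F) u := hu
    obtain ⟨v, hv, hvu⟩ := (mono_mem_fiberIdeal k F u).1 hu.prop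
    have : u ≤ v := hu.le_of_le ((mono_mem_fiberIdeal k F v).2 ⟨v, hv, le_rfl⟩) hvu
    rwa [le_antisymm this hvu]
  ext a
  constructor
  · rintro ⟨u, hu, rfl⟩
    exact ⟨u, key u hu, rfl⟩
  · rintro ⟨u, hu, rfl⟩
    obtain ⟨g, hgu, hg⟩ := exists_minimal_le_of_wellFoundedLT
      (fun v => mono k v ∈ fiberIdeal k F) u ((mono_mem_fiberIdeal k F u).2 ⟨u, hu, le_rfl⟩)
    refine ⟨g, hg, ?_⟩
    obtain ⟨d, rfl⟩ := exists_add_of_le hgu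
    have h := sub_mem_of_mem F (key g hg) hu
    rw [toInt_add, add_sub_cancel_left] at h
    have h2 : toInt (d + 0) ∈ L := by simpa using h
    rw [add_comm, outside_eq_of_add h2]

theorem exists_shift {n : ℕ} {L : AddSubgroup (Fin n → ℤ)} {F G : Fiber L}
    (h : F ≤ G) (h' : G ≤ F) :
    ∃ a : Fin n →₀ ℕ, (∀ v ∈ F.1, a + v ∈ G.1) ∧ ∀ v, outside L (a + v) = outside L v := by
  obtain ⟨a, ha⟩ := h
  obtain ⟨b, hb⟩ := h'
  refine ⟨a, ha, fun v => outside_eq_of_add (b := b) ?_ v⟩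
  obtain ⟨w, hw⟩ : ∃ w, w ∈ F.1 := by
    obtain ⟨F, w, rfl⟩ := F
    exact ⟨w, by simp [fiberSet]⟩
  have := sub_mem_of_mem F hw (hb _ (ha _ hw))
  rw [← add_assoc, toInt_add, add_sub_cancel_right, add_comm] at this
  exact this

theorem mono_mul (k : Type*) [Field k] {n : ℕ} (a u : Fin n →₀ ℕ) :
    mono k (a + u) = mono k a * mono k u := by
  simp [mono, monomial_mul]

theorem vertexSet_le (k : Type*) [Field k] {n : ℕ} {L : AddSubgroup (Fin n → ℤ)} {F G : Fiber L}
    (h : F ≤ G) (h' : G ≤ F) : vertexSet k F ⊆ vertexSet k G := by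
  obtain ⟨a, ha, ho⟩ := exists_shift h h'
  rw [vertexSet_eq, vertexSet_eq]
  rintro _ ⟨u, hu, rfl⟩
  exact ⟨a + u, ha u hu, ho u⟩

theorem edgeGraph_le (k : Type*) [Field k] {n : ℕ} {L : AddSubgroup (Fin n → ℤ)} {F G : Fiber L}
    (h : F ≤ G) (h' : G ≤ F) : edgeGraph k F ≤ edgeGraph k G := by
  obtain ⟨a, ha, ho⟩ := exists_shift h h'
  have hc : F.cls = G.cls := Quotient.sound ⟨h, h'⟩
  rintro x y ⟨hxy, u, hu, v, hv, h1, h2, hm⟩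
  refine ⟨hxy, a + u, ha u hu, a + v, ha v hv, (ho u).trans h1, (ho v).trans h2, ?_⟩
  rw [mono_mul, mono_mul, ← mul_sub, ← hc]
  exact Ideal.mul_mem_left _ _ hm

theorem card_gammaVertex_congr (k : Type*) [Field k] {n : ℕ} {L : AddSubgroup (Fin n → ℤ)}
    {F G : Fiber L} (h : F ≤ G) (h' : G ≤ F) :
    ENat.card (GammaVertex k F) = ENat.card (GammaVertex k G) := by
  have hV : vertexSet k F = vertexSet k G :=
    Set.Subset.antisymm (vertexSet_le k h h') (vertexSet_le k h' h)
  have hE : edgeGraph k F = edgeGraph k G :=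
    le_antisymm (edgeGraph_le k h h') (edgeGraph_le k h' h)
  unfold GammaVertex graphG
  rw [hV, hE]

/-- `t(F̄)`, the number of vertices of `Γ_F̄`. -/
def t (k : Type*) [Field k] {n : ℕ} {L : AddSubgroup (Fin n → ℤ)} (c : FiberClass L) : ℕ∞ :=
  Quotient.lift (fun F : Fiber L => ENat.card (GammaVertex k F))
    (fun F G (h : F ≤ G ∧ G ≤ F) => card_gammaVertex_congr k h.1 h.2) c

end

end LatticeIdeal

/-! A set `T` of binomials generates `I_L` exactly when its pairs of exponents generate congruence
modulo `L` on `ℕⁿ`; the essential half is `binomialCon_of_mem_span`. This makes it possible to count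
the elements of `T` one fiber class at a time.

Lower bounds. If `c` is not the class of `1`, a translate of a binomial of smaller class lies in
`I_{<c}` and stays inside one component of the graph, so the elements of `T` of class `c` must
connect all `t(c)` components: at least `t(c) - 1` are needed (`card_gammaVertex_le`). In the class
of `1` all exponents are supported on `σ`, and the exponent differences of the elements of `T` of
that class generate `L_pure`: at least `rank(L_pure)` are needed (`finrank_pureSublattice_le`).

Both bounds are attained at once (`exists_genSet_encard_part_le`): take `x^w - 1` for `w` in a
nonnegative generating set of `L_pure` of size at most its rank, and a star joining the components
in every other class. By noetherianity a finite subset `S` still generates, and the lower bounds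
keep its count exact in each class. Hence `S` is a Markov basis, every Markov basis has its elements
in the classes met by `S`, and summing over these classes gives the formula. -/

namespace LatticeIdeal

open MvPolynomial

noncomputable section

/-! ### Binomial ideals and congruences -/

section Congruence

variable {k : Type*} [Field k] {n : ℕ}

/-- A nonzero binomial determines the unordered pair of its two monomials. -/
theorem eq_or_swap_of_binomial_eq {u v u' v' : Fin n →₀ ℕ} (huv : u ≠ v)
    (h : mono k u - mono k v = mono k u' - mono k v') :
    (u = u' ∧ v = v') ∨ (u = v' ∧ v = u') := by
  classical
  have hu := congrArg (coeff u) h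
  have hv := congrArg (coeff v) h
  simp only [mono, coeff_sub, coeff_monomial, huv, huv.symm, if_true, if_false] at hu hv
  have h1 : u = u' ∨ u = v' := by
    by_contra! hc
    simp [hc.1.symm, hc.2.symm] at hu
  have h2 : v = u' ∨ v = v' := by
    by_contra! hc
    simp [hc.1.symm, hc.2.symm] at hv
  rcases h1 with rfl | rfl <;> rcases h2 with rfl | rfl <;>
    first | exact absurd rfl huv | exact Or.inl ⟨rfl, rfl⟩ | exact Or.inr ⟨rfl, rfl⟩

/-- The congruence on exponent vectors generated by the binomials in `T`. -/
def binomialCon (T : Set (MvPolynomial (Fin n) k)) : AddCon (Fin n →₀ ℕ) :=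
  addConGen fun u v => mono k u - mono k v ∈ T

/-- The congruence of the pairs whose binomial lies in the ideal `J`. -/
def idealCon (J : Ideal (MvPolynomial (Fin n) k)) : AddCon (Fin n →₀ ℕ) where
  r u v := mono k u - mono k v ∈ J
  iseqv :=
    { refl := fun u => by simp
      symm := fun {u v} h => by rw [← neg_sub]; exact neg_mem h
      trans := fun {u v w} h h' => by simpa using add_mem h h' }
  add' := fun {u v u' v'} h h' => by
    have h1 := J.mul_mem_left (mono k u') h
    have h2 := J.mul_mem_left (mono k v) h'
    have : mono k (u + u') - mono k (v + v') =
        mono k u' * (mono k u - mono k v) + mono k v * (mono k u' - mono k v') := by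
      rw [mono_mul, mono_mul]; ring
    rw [this]
    exact add_mem h1 h2

/-- The monoid algebra of the quotient of `ℕⁿ` by the congruence receives a ring map that kills `T`.
Its basis elements are the congruence classes, so two monomials with equal image are congruent. -/
theorem binomialCon_of_mem_span {T : Set (MvPolynomial (Fin n) k)} (hT : ∀ p ∈ T, IsBinomial p)
    {u v : Fin n →₀ ℕ} (h : mono k u - mono k v ∈ Ideal.span T) : binomialCon T u v := by
  let φ := AddMonoidAlgebra.mapDomainRingHom k (binomialCon T).mk'
  have hφ : ∀ w, φ (mono k w) = AddMonoidAlgebra.single ((w : (binomialCon T).Quotient)) 1 :=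
    fun w => AddMonoidAlgebra.mapDomain_single
  have hker : Ideal.span T ≤ RingHom.ker φ := by
    refine Ideal.span_le.2 fun p hp => ?_
    obtain ⟨a, b, rfl⟩ := hT p hp
    have hab : binomialCon T a b := AddConGen.Rel.of _ _ hp
    have hab' : (a : (binomialCon T).Quotient) = b := (AddCon.eq _).2 hab
    simp only [SetLike.mem_coe, RingHom.mem_ker, map_sub, hφ, hab', sub_self]
  have h0 := hker h
  rw [RingHom.mem_ker, map_sub, hφ, hφ, sub_eq_zero] at h0
  refine (AddCon.eq _).1 ?_
  have h1 := congrArg (fun x => x.coeff ((u : (binomialCon T).Quotient))) h0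
  by_contra hne
  simp [AddMonoidAlgebra.coeff_single, Ne.symm hne] at h1

end Congruence

/-! ### Fibers -/

section Fibers

variable {n : ℕ} {L : AddSubgroup (Fin n → ℤ)}

theorem toInt_zero : toInt (0 : Fin n →₀ ℕ) = 0 := rfl

theorem toInt_injective : Function.Injective (toInt (n := n)) := fun u v h => by
  ext i
  have := congrFun h i
  simp only [toInt] at this
  exact_mod_cast this

theorem mem_of {u v : Fin n →₀ ℕ} : v ∈ (Fiber.of L u).1 ↔ toInt v - toInt u ∈ L := Iff.rfl

theorem self_mem_of (u : Fin n →₀ ℕ) : u ∈ (Fiber.of L u).1 := by simp [mem_of]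

theorem of_eq_of_mem {F : Fiber L} {u : Fin n →₀ ℕ} (hu : u ∈ F.1) : Fiber.of L u = F := by
  obtain ⟨F, w, rfl⟩ := F
  refine Subtype.ext (Set.ext fun v => ?_)
  have hu' : toInt u - toInt w ∈ L := hu
  change toInt v - toInt u ∈ L ↔ toInt v - toInt w ∈ L
  rw [← sub_add_sub_cancel (toInt v) (toInt u) (toInt w), L.add_mem_cancel_right hu']

theorem of_eq_of {u v : Fin n →₀ ℕ} (h : toInt u - toInt v ∈ L) :
    Fiber.of L u = Fiber.of L v := of_eq_of_mem (F := Fiber.of L v) h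

theorem Fiber.nonempty (F : Fiber L) : ∃ u, u ∈ F.1 := by
  obtain ⟨F, w, rfl⟩ := F
  exact ⟨w, self_mem_of w⟩

variable (L) in
/-- The class of the fiber of `x^u`. -/
def clsOf (u : Fin n →₀ ℕ) : FiberClass L := (Fiber.of L u).cls

theorem clsOf_eq_of_mem {F : Fiber L} {u : Fin n →₀ ℕ} (hu : u ∈ F.1) : clsOf L u = F.cls := by
  rw [clsOf, of_eq_of_mem hu]

theorem clsOf_congr {u v : Fin n →₀ ℕ} (h : toInt u - toInt v ∈ L) : clsOf L u = clsOf L v := by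
  rw [clsOf, of_eq_of h, clsOf]

theorem clsOf_le_clsOf {u v : Fin n →₀ ℕ} (h : u ≤ v) : clsOf L u ≤ clsOf L v := by
  obtain ⟨d, rfl⟩ := exists_add_of_le h
  change Fiber.of L u ≤ Fiber.of L (u + d)
  refine ⟨d, fun w hw => ?_⟩
  rw [mem_of] at hw ⊢
  rw [toInt_add, toInt_add]
  convert hw using 1
  abel

theorem clsOf_surjective : Function.Surjective (clsOf L) := by
  intro c
  induction c using Quotient.inductionOn with
  | h F =>
    obtain ⟨u, hu⟩ := F.nonempty
    exact ⟨u, clsOf_eq_of_mem hu⟩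

theorem clsOf_zero : clsOf L 0 = oneClass L := rfl

theorem oneClass_le (c : FiberClass L) : oneClass L ≤ c := by
  obtain ⟨u, rfl⟩ := clsOf_surjective c
  exact clsOf_le_clsOf (zero_le)

theorem oneClass_lt {c : FiberClass L} (hc : c ≠ oneClass L) : oneClass L < c :=
  lt_of_le_of_ne (oneClass_le c) hc.symm

/-- By Dickson's lemma, the classes are well-quasi-ordered. -/
instance : WellQuasiOrderedLE (FiberClass L) :=
  Monotone.wellQuasiOrderedLE_of_wellQuasiOrderedLE_of_surjective (f := clsOf L)
    (fun _ _ h => clsOf_le_clsOf h) clsOf_surjective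

theorem le_and_le_of_cls_eq {F G : Fiber L} (h : F.cls = G.cls) : F ≤ G ∧ G ≤ F :=
  Quotient.exact h

/-- Exponents in equivalent fibers can be translated from one fiber to the other by a monomial
which is invertible modulo `L`. -/
theorem exists_shift_of_cls_eq {F G : Fiber L} (h : F.cls = G.cls) :
    ∃ a b : Fin n →₀ ℕ, (∀ v ∈ F.1, a + v ∈ G.1) ∧ toInt (a + b) ∈ L := by
  obtain ⟨⟨a, ha⟩, ⟨b, hb⟩⟩ := le_and_le_of_cls_eq h
  refine ⟨a, b, ha, ?_⟩
  obtain ⟨w, hw⟩ := F.nonempty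
  have := sub_mem_of_mem F hw (hb _ (ha _ hw))
  rwa [← add_assoc, toInt_add, add_sub_cancel_right, add_comm] at this

/-- Returning from the fiber of `a + u` to that of `u` gives `b` with `a + b ∈ L⁺`, so `a` vanishes
off `σ`. -/
theorem outside_add_of_clsOf_eq {a u : Fin n →₀ ℕ} (h : clsOf L (a + u) = clsOf L u) :
    outside L (a + u) = outside L u := by
  obtain ⟨b, hb⟩ := (le_and_le_of_cls_eq h).1
  have hb' := hb _ (self_mem_of _)
  rw [mem_of, ← add_assoc, toInt_add, add_sub_cancel_right, add_comm] at hb'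
  exact outside_eq_of_add hb' u

/-- A pair of monomials of the same fiber is moved to an equivalent fiber. -/
theorem exists_shift_pair {F : Fiber L} {u v : Fin n →₀ ℕ} (huv : toInt u - toInt v ∈ L)
    (hu : clsOf L u = F.cls) :
    ∃ a b : Fin n →₀ ℕ, toInt (a + b) ∈ L ∧ a + u ∈ F.1 ∧ a + v ∈ F.1 ∧
      outside L (a + u) = outside L u ∧ outside L (a + v) = outside L v := by
  obtain ⟨a, b, ha, hab⟩ := exists_shift_of_cls_eq (F := Fiber.of L u) (G := F) hu
  have hv : v ∈ (Fiber.of L u).1 := by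
    rw [mem_of, ← neg_sub]
    exact neg_mem huv
  exact ⟨a, b, hab, ha u (self_mem_of u), ha v hv, outside_eq_of_add hab u,
    outside_eq_of_add hab v⟩

/-- Congruence modulo `L` is itself a congruence containing the defining pairs of `I_L`, so it
contains the congruence they generate. -/
theorem mono_sub_mono_mem_latticeIdeal {k : Type*} [Field k] {u v : Fin n →₀ ℕ} :
    mono k u - mono k v ∈ latticeIdeal k L ↔ toInt u - toInt v ∈ L := by
  constructor
  · intro h
    have h' := binomialCon_of_mem_span (by rintro p ⟨a, b, -, rfl⟩; exact ⟨a, b, rfl⟩) h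
    let E : AddCon (Fin n →₀ ℕ) :=
      { r := fun u v => toInt u - toInt v ∈ L
        iseqv :=
          { refl := fun u => by simp
            symm := fun {u v} h => by rw [← neg_sub]; exact neg_mem h
            trans := fun {u v w} h h' => by simpa using add_mem h h' }
        add' := fun {u v u' v'} h h' => by
          rw [toInt_add, toInt_add, add_sub_add_comm]
          exact add_mem h h' }
    have hE : binomialCon {p : MvPolynomial (Fin n) k | ∃ u v : Fin n →₀ ℕ,
        toInt u - toInt v ∈ L ∧ p = mono k u - mono k v} ≤ E := by
      refine AddCon.addConGen_le.2 ?_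
      rintro u v ⟨u', v', h, he⟩
      change toInt u - toInt v ∈ L
      by_cases huv : u = v
      · simp [huv]
      · rcases eq_or_swap_of_binomial_eq huv he with ⟨rfl, rfl⟩ | ⟨rfl, rfl⟩
        · exact h
        · rw [← neg_sub]
          exact neg_mem h
    exact hE h'
  · intro h
    exact Ideal.subset_span ⟨u, v, h, rfl⟩

end Fibers

/-! ### The pure part -/

section Pure

variable {n : ℕ} {L : AddSubgroup (Fin n → ℤ)}

theorem exists_toInt_eq {w : Fin n → ℤ} (hw : 0 ≤ w) : ∃ u : Fin n →₀ ℕ, toInt u = w := by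
  refine ⟨Finsupp.equivFunOnFinite.symm fun i => (w i).toNat, ?_⟩
  funext i
  simp only [toInt, Finsupp.equivFunOnFinite_symm_apply_apply]
  exact Int.toNat_of_nonneg (hw i)

theorem toInt_nonneg (u : Fin n →₀ ℕ) : 0 ≤ toInt u := fun i => by simp [toInt]

theorem toInt_nsmul (N : ℕ) (u : Fin n →₀ ℕ) : toInt (N • u) = N • toInt u := by
  funext i
  simp [toInt]

/-- If every coordinate in `s` is positive on some element of an additive submonoid of `ℕⁿ`, then
some element is positive on all of `s`. -/
theorem exists_mem_forall_pos (P : AddSubmonoid (Fin n →₀ ℕ)) (s : Set (Fin n))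
    (h : ∀ i ∈ s, ∃ w ∈ P, w i ≠ 0) : ∃ e ∈ P, ∀ i ∈ s, 0 < e i := by
  classical
  choose! f hf hfi using h
  refine ⟨∑ i with i ∈ s, f i, sum_mem fun i hi => hf i (by simpa using hi), fun i hi => ?_⟩
  rw [Finsupp.finsetSum_apply]
  exact (Nat.pos_of_ne_zero (hfi i hi)).trans_le
    (Finset.single_le_sum (f := fun j => f j i) (fun _ _ => Nat.zero_le _) (by simpa using hi))

variable (L) in
/-- The submonoid `L⁺` of `ℕⁿ`. -/
def posSubmonoid : AddSubmonoid (Fin n →₀ ℕ) where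
  carrier := {u | toInt u ∈ L}
  zero_mem' := by simp [toInt_zero]
  add_mem' := fun {u v} hu hv => by
    rw [Set.mem_ofPred_eq, toInt_add]
    exact add_mem hu hv

variable (L) in
theorem exists_pos_on_sigma : ∃ e : Fin n →₀ ℕ, toInt e ∈ L ∧ ∀ i ∈ sigma L, 0 < e i := by
  refine exists_mem_forall_pos (posSubmonoid L) (sigma L) ?_
  rintro i ⟨w, hw, hi⟩
  obtain ⟨u, rfl⟩ := exists_toInt_eq hw.2
  exact ⟨u, hw.1, fun h => hi (by simp [toInt, h])⟩

theorem clsOf_eq_oneClass_of_mem {u : Fin n →₀ ℕ} (h : toInt u ∈ L) : clsOf L u = oneClass L :=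
  clsOf_congr (v := 0) (by simpa [toInt_zero] using h)

theorem le_degree_nsmul {u e : Fin n →₀ ℕ} (h : ∀ i, u i ≠ 0 → 0 < e i) : u ≤ u.degree • e := by
  intro i
  by_cases hi : u i = 0
  · simp [hi]
  · exact (Finsupp.le_degree i u).trans (Nat.le_mul_of_pos_right _ (h i hi))

/-- Such a monomial divides a power of `x^e`, where `e ∈ L⁺` is positive on `σ`; those powers have
the class of `1`, which is the least class. -/
theorem clsOf_eq_oneClass_of_support {u : Fin n →₀ ℕ} (h : ∀ i, i ∉ sigma L → u i = 0) :
    clsOf L u = oneClass L := by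
  obtain ⟨e, heL, he⟩ := exists_pos_on_sigma L
  refine le_antisymm ?_ (oneClass_le _)
  have hle : u ≤ u.degree • e :=
    le_degree_nsmul fun i hi => he i (by by_contra hc; exact hi (h i hc))
  refine (clsOf_le_clsOf hle).trans_eq (clsOf_eq_oneClass_of_mem ?_)
  rw [toInt_nsmul]
  exact nsmul_mem heL _

theorem apply_eq_zero_of_clsOf_eq_oneClass {u : Fin n →₀ ℕ} (h : clsOf L u = oneClass L)
    {i : Fin n} (hi : i ∉ sigma L) : u i = 0 := by
  have h' : clsOf L (u + 0) = clsOf L 0 := by simpa [clsOf_zero] using h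
  have := congrFun (outside_add_of_clsOf_eq h') ⟨i, hi⟩
  simpa [outside] using this

theorem apply_eq_zero_of_mem_pureSublattice {x : Fin n → ℤ} (hx : x ∈ pureSublattice L)
    {i : Fin n} (hi : i ∉ sigma L) : x i = 0 := by
  induction hx using AddSubgroup.closure_induction with
  | mem w hw =>
    by_contra hc
    exact hi ⟨w, hw, hc⟩
  | zero => rfl
  | add x y _ _ hx hy => simp [hx, hy]
  | neg x _ hx => simp [hx]

variable (L) in
theorem pureSublattice_le : pureSublattice L ≤ L :=
  (AddSubgroup.closure_le _).2 fun _ hw => hw.1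

/-- Adding a large multiple of an element of `L⁺` positive on `σ` makes `x` nonnegative, so `x` is a
difference of two elements of `L⁺`. -/
theorem mem_pureSublattice_of_support {x : Fin n → ℤ} (hx : x ∈ L)
    (h : ∀ i, i ∉ sigma L → x i = 0) : x ∈ pureSublattice L := by
  obtain ⟨e, heL, he⟩ := exists_pos_on_sigma L
  set N : ℕ := ∑ i, (x i).natAbs with hN
  have he' : N • toInt e ∈ posPart L :=
    ⟨nsmul_mem heL _, nsmul_nonneg (toInt_nonneg e) _⟩
  have hx' : x + N • toInt e ∈ posPart L := by
    refine ⟨add_mem hx he'.1, fun i => ?_⟩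
    by_cases hi : i ∈ sigma L
    · have h1 : (x i).natAbs ≤ N := Finset.single_le_sum
        (f := fun i => (x i).natAbs) (fun _ _ => Nat.zero_le _) (Finset.mem_univ i)
      have h2 : N ≤ N * e i := Nat.le_mul_of_pos_right _ (he i hi)
      have h3 : (N : ℤ) ≤ N * e i := by exact_mod_cast h2
      have h4 : (N • toInt e) i = N * e i := by simp [toInt]
      change 0 ≤ x i + (N • toInt e) i
      rw [h4]
      omega
    · have : 0 ≤ (N • toInt e) i := he'.2 i
      simpa [h i hi] using this
  have := sub_mem (AddSubgroup.subset_closure hx') (AddSubgroup.subset_closure he')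
  rwa [add_sub_cancel_right] at this

end Pure

/-! ### Components of the graph of a class -/

section Components

variable {k : Type*} [Field k] {n : ℕ} {L : AddSubgroup (Fin n → ℤ)}

theorem mem_idealLT {c : FiberClass L} {u v : Fin n →₀ ℕ} (h : toInt u - toInt v ∈ L)
    (hc : clsOf L u < c) : mono k u - mono k v ∈ idealLT k c :=
  Ideal.subset_span ⟨mono_sub_mono_mem_latticeIdeal.2 h, u, v, rfl, hc⟩

/-- After division by the gcd, both monomials are supported on `σ` and so have the class of `1`,
which lies strictly below `c`. -/
theorem mem_idealLT_of_outside_eq {c : FiberClass L} (hc : c ≠ oneClass L) {u v : Fin n →₀ ℕ}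
    (huv : toInt u - toInt v ∈ L) (ho : outside L u = outside L v) :
    mono k u - mono k v ∈ idealLT k c := by
  obtain ⟨u', hu⟩ := exists_add_of_le (inf_le_left : u ⊓ v ≤ u)
  obtain ⟨v', hv⟩ := exists_add_of_le (inf_le_right : u ⊓ v ≤ v)
  set m := u ⊓ v with hm
  have hL : toInt u' - toInt v' ∈ L := by
    rw [hu, hv, toInt_add, toInt_add, add_sub_add_left_eq_sub] at huv
    exact huv
  have hcls : clsOf L u' = oneClass L := by
    refine clsOf_eq_oneClass_of_support fun i hi => ?_
    have h1 : u i = v i := congrFun ho ⟨i, hi⟩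
    have h2 : m i = u i := by rw [hm, Finsupp.inf_apply, ← h1, inf_idem]
    have h3 : u i = m i + u' i := by rw [← Finsupp.add_apply, ← hu]
    omega
  rw [hu, hv, mono_mul, mono_mul, ← mul_sub]
  exact Ideal.mul_mem_left _ _ (mem_idealLT hL (hcls ▸ oneClass_lt hc))

theorem outside_mem_vertexSet {F : Fiber L} {u : Fin n →₀ ℕ} (hu : u ∈ F.1) :
    outside L u ∈ vertexSet k F := by
  rw [vertexSet_eq]
  exact ⟨u, hu, rfl⟩

/-- Minimal generators form an antichain in `ℕⁿ`, finite by Dickson's lemma. -/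
theorem vertexSet_finite (F : Fiber L) : (vertexSet k F).Finite := by
  refine Set.Finite.image _ (WellQuasiOrderedLE.finite_of_isAntichain ?_)
  exact setOfPred_minimal_antichain _

instance (F : Fiber L) : Finite (GammaVertex k F) := by
  have : Finite (vertexSet k F) := vertexSet_finite F
  infer_instance

instance (F : Fiber L) : Nonempty (GammaVertex k F) := by
  obtain ⟨u, hu⟩ := F.nonempty
  exact ⟨(graphG k F).connectedComponentMk ⟨_, outside_mem_vertexSet hu⟩⟩

open Classical in
variable (k) in
/-- The component of `u^σ`, for `x^u` in a fiber equivalent to `F`. -/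
def node (F : Fiber L) (u : Fin n →₀ ℕ) : GammaVertex k F :=
  if h : outside L u ∈ vertexSet k F then (graphG k F).connectedComponentMk ⟨outside L u, h⟩
  -- Not reached when the fiber of `x^u` is equivalent to `F`: translation into `F` preserves `u^σ`.
  else Classical.arbitrary _

theorem node_of_mem {F : Fiber L} {u : Fin n →₀ ℕ} (hu : u ∈ F.1) :
    node k F u = (graphG k F).connectedComponentMk ⟨outside L u, outside_mem_vertexSet hu⟩ :=
  dif_pos _

theorem node_congr {F : Fiber L} {u v : Fin n →₀ ℕ} (h : outside L u = outside L v) :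
    node k F u = node k F v := by
  by_cases hv : outside L v ∈ vertexSet k F
  · have hu : outside L u ∈ vertexSet k F := h ▸ hv
    rw [node, node, dif_pos hu, dif_pos hv]
    exact congrArg _ (Subtype.ext h)
  · have hu : outside L u ∉ vertexSet k F := h ▸ hv
    rw [node, node, dif_neg hu, dif_neg hv]

theorem exists_node_eq {F : Fiber L} (C : GammaVertex k F) : ∃ u ∈ F.1, node k F u = C := by
  induction C using SimpleGraph.ConnectedComponent.ind with
  | h a =>
    obtain ⟨a, ha⟩ := a
    have ha' := ha
    rw [vertexSet_eq] at ha'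
    obtain ⟨u, hu, rfl⟩ := ha'
    exact ⟨u, hu, node_of_mem hu⟩

theorem node_eq_of_mem_idealLT {F : Fiber L} {u v : Fin n →₀ ℕ} (hu : u ∈ F.1) (hv : v ∈ F.1)
    (h : mono k u - mono k v ∈ idealLT k F.cls) : node k F u = node k F v := by
  by_cases ho : outside L u = outside L v
  · exact node_congr ho
  · rw [node_of_mem hu, node_of_mem hv]
    refine SimpleGraph.ConnectedComponent.sound (SimpleGraph.Adj.reachable ?_)
    exact ⟨ho, u, hu, v, hv, rfl, rfl, h⟩

/-- Consecutive edges of a walk may use different monomials over the same vertex. Exchanging them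
costs an element of `I_{<F̄}` only because the class is not that of `1`. -/
theorem mem_idealLT_of_node_eq {F : Fiber L} (hF : F.cls ≠ oneClass L) {u v : Fin n →₀ ℕ}
    (hu : u ∈ F.1) (hv : v ∈ F.1) (h : node k F u = node k F v) :
    mono k u - mono k v ∈ idealLT k F.cls := by
  have key : ∀ {a b : vertexSet k F}, (graphG k F).Walk a b → ∀ {u v : Fin n →₀ ℕ}, u ∈ F.1 →
      v ∈ F.1 → outside L u = a → outside L v = b → mono k u - mono k v ∈ idealLT k F.cls := by
    intro a b w
    induction w with
    | nil =>
      intro u v hu hv h1 h2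
      exact mem_idealLT_of_outside_eq hF (sub_mem_of_mem F hv hu) (h1.trans h2.symm)
    | cons hadj _ ih =>
      intro u v hu hv h1 h2
      obtain ⟨-, u', hu', v', hv', h1', h2', hm⟩ := hadj
      have e1 := mem_idealLT_of_outside_eq (k := k) hF (sub_mem_of_mem F hu' hu)
        (h1.trans h1'.symm)
      have e2 := ih hv' hv h2' h2
      have := add_mem (add_mem e1 hm) e2
      simpa using this
  rw [node_of_mem hu, node_of_mem hv] at h
  obtain ⟨w⟩ := SimpleGraph.ConnectedComponent.exact h
  exact key w hu hv rfl rfl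

theorem t_cls (F : Fiber L) : t k F.cls = ENat.card (GammaVertex k F) := rfl

end Components

/-! ### Lower bounds for generating sets -/

section LowerBound

variable {k : Type*} [Field k] {n : ℕ} {L : AddSubgroup (Fin n → ℤ)}

variable (L) in
/-- The nonzero binomials of `T` whose fiber has class `c`. -/
def part (T : Set (MvPolynomial (Fin n) k)) (c : FiberClass L) : Set (MvPolynomial (Fin n) k) :=
  {p | p ∈ T ∧ ∃ u v, u ≠ v ∧ p = mono k u - mono k v ∧ clsOf L u = c}

/-- `T` consists of binomials and generates `I_L`. -/
structure IsBinomialGenSet (L : AddSubgroup (Fin n → ℤ)) (T : Set (MvPolynomial (Fin n) k)) :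
    Prop where
  isBinomial : ∀ p ∈ T, IsBinomial p
  span_eq : Ideal.span T = latticeIdeal k L

variable {T : Set (MvPolynomial (Fin n) k)}

theorem IsBinomialGenSet.sub_mem (hT : IsBinomialGenSet L T) {u v : Fin n →₀ ℕ}
    (h : mono k u - mono k v ∈ T) : toInt u - toInt v ∈ L := by
  rw [← mono_sub_mono_mem_latticeIdeal (k := k), ← hT.span_eq]
  exact Ideal.subset_span h

/-- To prove a property of all pairs congruent modulo `L`, it suffices to prove it for the pairs
in a binomial generating set, if it is a translation-invariant equivalence relation. -/
theorem IsBinomialGenSet.induction (hT : IsBinomialGenSet L T)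
    {r : (Fin n →₀ ℕ) → (Fin n →₀ ℕ) → Prop}
    (of : ∀ u v, mono k u - mono k v ∈ T → r u v)
    (refl : ∀ u, r u u)
    (symm : ∀ u v, toInt u - toInt v ∈ L → r u v → r v u)
    (trans : ∀ u v w, toInt u - toInt v ∈ L → toInt v - toInt w ∈ L → r u v → r v w → r u w)
    (add : ∀ a u v, toInt u - toInt v ∈ L → r u v → r (a + u) (a + v))
    {u v : Fin n →₀ ℕ} (h : toInt u - toInt v ∈ L) : r u v := by
  have hc : binomialCon T u v := by
    refine binomialCon_of_mem_span hT.isBinomial ?_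
    rw [hT.span_eq]
    exact mono_sub_mono_mem_latticeIdeal.2 h
  have hadd : ∀ a {u v : Fin n →₀ ℕ}, toInt u - toInt v ∈ L →
      toInt (a + u) - toInt (a + v) ∈ L := fun a u v h => by
    rwa [toInt_add, toInt_add, add_sub_add_left_eq_sub]
  have htr : ∀ {u v w : Fin n →₀ ℕ}, toInt u - toInt v ∈ L ∧ r u v → toInt v - toInt w ∈ L ∧ r v w →
      toInt u - toInt w ∈ L ∧ r u w := fun h h' =>
    ⟨by simpa using add_mem h.1 h'.1, trans _ _ _ h.1 h'.1 h.2 h'.2⟩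
  let E : AddCon (Fin n →₀ ℕ) :=
    { r := fun u v => toInt u - toInt v ∈ L ∧ r u v
      iseqv :=
        { refl := fun u => ⟨by simp, refl u⟩
          symm := fun {u v} h => ⟨by rw [← neg_sub]; exact neg_mem h.1, symm u v h.1 h.2⟩
          trans := htr }
      add' := fun {u v u' v'} h h' => by
        have h1 := add u' u v h.1 h.2
        rw [add_comm u' u, add_comm u' v] at h1
        have h2 := hadd u' h.1
        rw [add_comm u' u, add_comm u' v] at h2
        exact htr ⟨h2, h1⟩ ⟨hadd v h'.1, add v _ _ h'.1 h'.2⟩ }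
  have hE : binomialCon T ≤ E := AddCon.addConGen_le.2 fun u v h => ⟨hT.sub_mem h, of u v h⟩
  exact (hE hc).2

/-- A generating set has at least `t(c) - 1` elements of class `c`. -/
theorem IsBinomialGenSet.card_gammaVertex_le (hT : IsBinomialGenSet L T) (F : Fiber L) :
    ENat.card (GammaVertex k F) ≤ (part L T F.cls).encard + 1 := by
  classical
  rcases (part L T F.cls).finite_or_infinite with hfin | hinf
  swap
  · simp [hinf.encard_eq]
  -- The edges of `H` come from the elements of `T` of class `F.cls`; `H` will be shown connected.
  let H : SimpleGraph (GammaVertex k F) := SimpleGraph.fromRel fun C D =>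
    ∃ u v, mono k u - mono k v ∈ T ∧ clsOf L u = F.cls ∧ node k F u = C ∧ node k F v = D
  have hreach : ∀ {u v : Fin n →₀ ℕ}, toInt u - toInt v ∈ L → clsOf L u = F.cls →
      H.Reachable (node k F u) (node k F v) := by
    intro u v huv
    refine hT.induction (r := fun u v => clsOf L u = F.cls →
      H.Reachable (node k F u) (node k F v)) ?_ ?_ ?_ ?_ ?_ huv
    · intro u v h hu
      by_cases hne : node k F u = node k F v
      · rw [hne]
      · exact SimpleGraph.Adj.reachable ⟨hne, Or.inl ⟨u, v, h, hu, rfl, rfl⟩⟩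
    · exact fun u _ => SimpleGraph.Reachable.refl _
    · exact fun u v h hr hv => (hr ((clsOf_congr h).trans hv)).symm
    · exact fun u v w h _ hr hr' hu => (hr hu).trans (hr' ((clsOf_congr h).symm.trans hu))
    · intro a u v h hr hau
      have hav : toInt (a + u) - toInt (a + v) ∈ L := by
        rwa [toInt_add, toInt_add, add_sub_add_left_eq_sub]
      -- If translation by `a` stays in the class, the coordinates off `σ` do not move. Otherwise
      -- `x^u` has smaller class, and the translated pair, moved into `F` by `s`, differs by an
      -- element of `I_{<F̄}`, so its nodes coincide.
      by_cases hu : clsOf L u = F.cls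
      · have h1 : outside L (a + u) = outside L u := outside_add_of_clsOf_eq (hau.trans hu.symm)
        have h2 : outside L (a + v) = outside L v := outside_add_of_clsOf_eq
          ((clsOf_congr hav).symm.trans (hau.trans (hu.symm.trans (clsOf_congr h))))
        rw [node_congr h1, node_congr h2]
        exact hr hu
      · obtain ⟨s, -, -, hsu, hsv, h1, h2⟩ := exists_shift_pair hav hau
        have hlt : clsOf L u < F.cls :=
          lt_of_le_of_ne (hau ▸ clsOf_le_clsOf le_add_self) hu
        have hm : mono k (s + (a + u)) - mono k (s + (a + v)) ∈ idealLT k F.cls := by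
          rw [← add_assoc, ← add_assoc, mono_mul k (s + a), mono_mul k (s + a), ← mul_sub]
          exact Ideal.mul_mem_left _ _ (mem_idealLT h hlt)
        rw [← node_congr h1, ← node_congr h2, node_eq_of_mem_idealLT hsu hsv hm]
  have hconn : H.Connected := by
    refine ⟨fun C D => ?_⟩
    obtain ⟨u, hu, rfl⟩ := exists_node_eq C
    obtain ⟨v, hv, rfl⟩ := exists_node_eq D
    exact hreach (sub_mem_of_mem F hv hu) (clsOf_eq_of_mem hu)
  have hedge : ∀ e : H.edgeSet, ∃ p : part L T F.cls, ∃ u v, u ≠ v ∧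
      p.1 = mono k u - mono k v ∧ e.1 = s(node k F u, node k F v) := by
    rintro ⟨e, he⟩
    induction e using Sym2.ind with
    | _ C D =>
      have hadj : H.Adj C D := he
      obtain ⟨hne, hr⟩ := (SimpleGraph.fromRel_adj _ _ _).1 hadj
      clear hadj
      revert he
      rcases hr with ⟨u, v, h, hu, rfl, rfl⟩ | ⟨u, v, h, hu, rfl, rfl⟩
      all_goals intro he
      · have huv : u ≠ v := fun h => hne (by rw [h])
        exact ⟨⟨_, h, u, v, huv, rfl, hu⟩, u, v, huv, rfl, rfl⟩
      · have huv : u ≠ v := fun h => hne (by rw [h])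
        exact ⟨⟨_, h, u, v, huv, rfl, hu⟩, u, v, huv, rfl, Sym2.eq_swap⟩
  choose f hf using hedge
  -- A nonzero binomial determines its unordered pair of monomials, hence its edge.
  have hinj : Function.Injective f := by
    intro e e' h
    obtain ⟨u, v, huv, hp, he⟩ := hf e
    obtain ⟨u', v', -, hp', he'⟩ := hf e'
    rw [h, hp'] at hp
    refine Subtype.ext ?_
    rw [he, he']
    rcases eq_or_swap_of_binomial_eq huv hp.symm with ⟨rfl, rfl⟩ | ⟨rfl, rfl⟩
    · rfl
    · exact Sym2.eq_swap
  have : Finite (part L T F.cls) := hfin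
  have h1 := hconn.card_vert_le_card_edgeSet_add_one
  have h2 : Nat.card H.edgeSet ≤ Nat.card (part L T F.cls) := Nat.card_le_card_of_injective f hinj
  rw [ENat.card_eq_coe_natCard, Set.encard, ENat.card_eq_coe_natCard]
  exact_mod_cast h1.trans (by omega)

/-- The elements of the class of `1` in a generating set are at least as many as the rank of the
pure sublattice. -/
theorem IsBinomialGenSet.finrank_pureSublattice_le (hT : IsBinomialGenSet L T) :
    (Module.finrank ℤ (pureSublattice L) : ℕ∞) ≤ (part L T (oneClass L)).encard := by
  classical
  rcases (part L T (oneClass L)).finite_or_infinite with hfin | hinf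
  swap
  · simp [hinf.encard_eq]
  have hex : ∀ p : part L T (oneClass L), ∃ x : pureSublattice L, ∃ u v, u ≠ v ∧
      p.1 = mono k u - mono k v ∧ x.1 = toInt u - toInt v := by
    rintro ⟨p, hp, u, v, huv, rfl, hu⟩
    refine ⟨⟨toInt u - toInt v, mem_pureSublattice_of_support (hT.sub_mem hp) fun i hi => ?_⟩,
      u, v, huv, rfl, rfl⟩
    have hv : clsOf L v = oneClass L := (clsOf_congr (hT.sub_mem hp)).symm.trans hu
    simp [toInt, apply_eq_zero_of_clsOf_eq_oneClass hu hi,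
      apply_eq_zero_of_clsOf_eq_oneClass hv hi]
  choose d hd using hex
  set D : AddSubgroup (Fin n → ℤ) := AddSubgroup.closure (Set.range fun p => (d p).1) with hD
  have key : ∀ {u v : Fin n →₀ ℕ}, toInt u - toInt v ∈ L → clsOf L u = oneClass L →
      toInt u - toInt v ∈ D := by
    intro u v huv
    refine hT.induction (r := fun u v => clsOf L u = oneClass L →
      toInt u - toInt v ∈ D) ?_ ?_ ?_ ?_ ?_ huv
    · intro u v h hu
      by_cases hne : u = v
      · simp [hne]
      have hmem : (d ⟨_, h, u, v, hne, rfl, hu⟩).1 ∈ D := AddSubgroup.subset_closure ⟨_, rfl⟩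
      obtain ⟨u', v', -, hp, hx⟩ := hd ⟨_, h, u, v, hne, rfl, hu⟩
      rw [hx] at hmem
      rcases eq_or_swap_of_binomial_eq hne hp with ⟨rfl, rfl⟩ | ⟨rfl, rfl⟩
      · exact hmem
      · rw [← neg_sub]
        exact neg_mem hmem
    · exact fun u _ => by simp
    · intro u v h hr hv
      rw [← neg_sub]
      exact neg_mem (hr ((clsOf_congr h).trans hv))
    · intro u v w h _ hr hr' hu
      simpa using add_mem (hr hu) (hr' ((clsOf_congr h).symm.trans hu))
    · intro a u v h hr hau
      rw [toInt_add, toInt_add, add_sub_add_left_eq_sub]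
      -- The class of `1` is least, so a divisor of a monomial of this class has this class too.
      exact hr (le_antisymm (hau ▸ clsOf_le_clsOf le_add_self) (oneClass_le _))
  have hle : pureSublattice L ≤ D := by
    refine (AddSubgroup.closure_le _).2 fun w hw => ?_
    obtain ⟨u, rfl⟩ := exists_toInt_eq hw.2
    simpa [toInt_zero] using key (u := u) (v := 0) (by simpa [toInt_zero] using hw.1)
      (clsOf_eq_oneClass_of_mem hw.1)
  have hspan : Submodule.span ℤ (Set.range d) = ⊤ := by
    have h2 : D ≤ (Submodule.span ℤ (Set.range d)).toAddSubgroup.map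
        (pureSublattice L).subtype := by
      refine (AddSubgroup.closure_le _).2 ?_
      rintro _ ⟨p, rfl⟩
      exact ⟨d p, Submodule.subset_span ⟨p, rfl⟩, rfl⟩
    refine eq_top_iff.2 fun x _ => ?_
    obtain ⟨y, hy, hyx⟩ := h2 (hle x.2)
    rwa [← Subtype.ext hyx]
  have : Fintype (part L T (oneClass L)) := hfin.fintype
  have h1 := finrank_le_of_span_eq_top hspan
  rw [Set.encard, ENat.card_eq_coe_fintype_card]
  exact_mod_cast h1

end LowerBound

/-! ### Construction of a generating set attaining the bounds -/

section Construction

variable {k : Type*} [Field k] {n : ℕ} {L : AddSubgroup (Fin n → ℤ)}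

variable (L) in
/-- The pure sublattice is generated by `rank` many nonnegative vectors. -/
theorem exists_pure_generators : ∃ W : Set (Fin n →₀ ℕ),
    W.encard ≤ (Module.finrank ℤ (pureSublattice L) : ℕ∞) ∧
      AddSubgroup.closure (toInt '' W) = pureSublattice L := by
  classical
  obtain ⟨e, heL, he⟩ := exists_pos_on_sigma L
  have heM : toInt e ∈ pureSublattice L := AddSubgroup.subset_closure ⟨heL, toInt_nonneg e⟩
  let w : pureSublattice L := ⟨toInt e, heM⟩
  by_cases hw : w = 0
  · refine ⟨∅, by simp, ?_⟩
    have hσ : ∀ i, i ∉ sigma L := fun i hi => by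
      have h1 : e i = 0 := by
        have : toInt e i = 0 := congrFun (congrArg Subtype.val hw) i
        simpa [toInt] using this
      exact absurd (he i hi) (by omega)
    rw [Set.image_empty, AddSubgroup.closure_empty, eq_comm, eq_bot_iff]
    intro x hx
    exact funext fun i => apply_eq_zero_of_mem_pureSublattice hx (hσ i)
  have : IsNoetherian ℤ (pureSublattice L) :=
    isNoetherian_of_injective (pureSublattice L).subtype.toIntLinearMap Subtype.val_injective
  -- Smith normal form for `ℤ w` yields a basis of `L_pure` with one vector proportional to `w`.
  -- That vector has constant sign on `σ`, and its multiples can be added to the other basis vectors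
  -- to make them nonnegative.
  obtain ⟨m, snf⟩ := Submodule.smithNormalForm (Module.Free.chooseBasis ℤ (pureSublattice L))
    (Submodule.span ℤ {w})
  obtain ⟨j⟩ : Nonempty (Fin m) := by
    by_contra hm
    rw [not_nonempty_iff] at hm
    have hsub := snf.bN.repr.toEquiv.subsingleton
    exact hw (congrArg Subtype.val (Subsingleton.elim
      (⟨w, Submodule.mem_span_singleton_self w⟩ : Submodule.span ℤ {w}) 0))
  set bM := snf.bM with hbM
  set j₀ := snf.f j with hj₀
  obtain ⟨z, hz⟩ := Submodule.mem_span_singleton.1 (snf.bN j).2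
  have hza : z • w = snf.a j • bM j₀ := hz.trans (snf.snf j)
  have hz0 : z ≠ 0 := by
    rintro rfl
    refine snf.bN.ne_zero j (Subtype.ext ?_)
    rw [← hz, zero_smul]
    rfl
  have hcoord : ∀ i, z * e i = snf.a j * (bM j₀).1 i := fun i => by
    have := congrFun (congrArg Subtype.val hza) i
    simpa [w, toInt] using this
  have hoff : ∀ (x : pureSublattice L) i, i ∉ sigma L → x.1 i = 0 :=
    fun x i hi => apply_eq_zero_of_mem_pureSublattice x.2 hi
  -- a generator of the saturation of `ℤ w` which is positive on `σ`
  obtain ⟨b, hb, hbpos⟩ : ∃ b : pureSublattice L, (b = bM j₀ ∨ b = -bM j₀) ∧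
      ∀ i ∈ sigma L, 0 < b.1 i := by
    have hsq : ∀ i ∈ sigma L, 0 < z * snf.a j * (bM j₀).1 i := fun i hi => by
      have h2 : (0 : ℤ) < e i := by exact_mod_cast he i hi
      rw [mul_assoc, ← hcoord, ← mul_assoc]
      exact mul_pos (mul_self_pos.2 hz0) h2
    rcases lt_or_ge 0 (z * snf.a j) with h | h
    · exact ⟨bM j₀, Or.inl rfl, fun i hi => (mul_pos_iff_of_pos_left h).1 (hsq i hi)⟩
    · refine ⟨-bM j₀, Or.inr rfl, fun i hi => ?_⟩
      have h1 : (bM j₀).1 i < 0 := by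
        by_contra! hc
        exact (mul_nonpos_of_nonpos_of_nonneg h hc).not_gt (hsq i hi)
      simpa using h1
  have hex : ∀ x : pureSublattice L, ∃ N : ℕ, 0 ≤ (x + N • b).1 := fun x => by
    refine ⟨∑ i, (x.1 i).natAbs, fun i => ?_⟩
    set N := ∑ i, (x.1 i).natAbs
    have h0 : (x + N • b).1 i = x.1 i + N * b.1 i := by simp
    rw [h0]
    by_cases hi : i ∈ sigma L
    · have h1 : (x.1 i).natAbs ≤ N := Finset.single_le_sum
        (f := fun i => (x.1 i).natAbs) (fun _ _ => Nat.zero_le _) (Finset.mem_univ i)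
      have h2 : (N : ℤ) ≤ N * b.1 i := le_mul_of_one_le_right (by positivity) (hbpos i hi)
      change 0 ≤ x.1 i + N * b.1 i
      omega
    · simp [hoff _ i hi]
  have hbnn : 0 ≤ b.1 := fun i => by
    by_cases hi : i ∈ sigma L
    · exact (hbpos i hi).le
    · simp [hoff _ i hi]
  choose N hN using hex
  have hg : ∀ i, ∃ u : Fin n →₀ ℕ,
      toInt u = (if i = j₀ then b else bM i + N (bM i) • b : pureSublattice L).1 := fun i => by
    refine exists_toInt_eq ?_
    split_ifs
    exacts [hbnn, hN _]
  choose g hg using hg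
  refine ⟨Set.range g, ?_, le_antisymm ?_ fun x hx => ?_⟩
  · rw [← Set.image_univ, Module.finrank_eq_card_chooseBasisIndex]
    refine (Set.encard_image_le _ _).trans ?_
    rw [Set.encard_univ, ENat.card_eq_coe_fintype_card]
  · rw [AddSubgroup.closure_le]
    rintro _ ⟨_, ⟨i, rfl⟩, rfl⟩
    rw [hg]
    exact Subtype.property _
  · set D := AddSubgroup.closure (toInt '' Set.range g)
    have hD : ∀ i, (if i = j₀ then b else bM i + N (bM i) • b : pureSublattice L).1 ∈ D :=
      fun i => hg i ▸ AddSubgroup.subset_closure ⟨_, ⟨i, rfl⟩, rfl⟩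
    have hbD : b.1 ∈ D := by simpa using hD j₀
    have hbMD : ∀ i, (bM i).1 ∈ D := fun i => by
      by_cases hi : i = j₀
      · rw [hi]
        rcases hb with rfl | rfl
        · exact hbD
        · simpa using hbD
      · have h1 := hD i
        rw [if_neg hi] at h1
        have h2 := sub_mem h1 (nsmul_mem hbD (N (bM i)))
        simpa using h2
    have hspan : Submodule.span ℤ (Set.range bM) ≤
        (D.comap (pureSublattice L).subtype).toIntSubmodule := by
      rw [Submodule.span_le]
      rintro _ ⟨i, rfl⟩
      exact hbMD i
    rw [bM.span_eq] at hspan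
    exact hspan (x := ⟨x, hx⟩) trivial

/-- Translation by an element which is invertible modulo a congruence can be cancelled. -/
theorem rel_of_add_left_of_rel_zero {M : Type*} [AddCommMonoid M] (C : AddCon M)
    {s s' u v : M} (hs : C (s' + s) 0) (h : C (s + u) (s + v)) : C u v := by
  have h1 : ∀ w, C (s' + s + w) w := fun w => by simpa using C.add hs (C.refl w)
  have h2 : C (s' + s + u) (s' + s + v) := by
    rw [add_assoc, add_assoc]
    exact C.add (C.refl s') h
  exact C.trans (C.symm (h1 u)) (C.trans h2 (h1 v))

/-- A congruence which identifies generators of the pure sublattice with `0` contains the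
congruence modulo the pure sublattice. -/
theorem rel_of_sub_mem_pureSublattice (C : AddCon (Fin n →₀ ℕ)) {W : Set (Fin n →₀ ℕ)}
    (hW : AddSubgroup.closure (toInt '' W) = pureSublattice L) (hC : ∀ w ∈ W, C w 0)
    {u v : Fin n →₀ ℕ} (huv : toInt u - toInt v ∈ pureSublattice L) : C u v := by
  -- If every exponent congruent to `0` vanished at some `i ∈ σ`, then so would `W`, hence all of
  -- `L_pure`, contradicting `i ∈ σ`.
  obtain ⟨e, heC, he⟩ : ∃ e, C e 0 ∧ ∀ i ∈ sigma L, 0 < e i := by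
    let P : AddSubmonoid (Fin n →₀ ℕ) :=
      { carrier := {u | C u 0}
        zero_mem' := C.refl 0
        add_mem' := fun {u v} hu hv => by simpa using C.add hu hv }
    refine exists_mem_forall_pos P (sigma L) ?_
    rintro i ⟨x, hx, hi⟩
    by_contra! hc
    have hx' : x ∈ AddSubgroup.closure (toInt '' W) := hW ▸ AddSubgroup.subset_closure hx
    refine hi ?_
    clear hi hx
    induction hx' using AddSubgroup.closure_induction with
    | mem y hy =>
      obtain ⟨w, hw, rfl⟩ := hy
      simp [toInt, hc w (hC w hw)]
    | zero => rfl
    | add x y _ _ hx hy => simp [hx, hy]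
    | neg x _ hx => simp [hx]
  have hNe : ∀ N : ℕ, C (N • e) 0 := fun N => by simpa using C.nsmul N heC
  rw [← hW] at huv
  generalize hx : toInt u - toInt v = x at huv
  induction huv using AddSubgroup.closure_induction generalizing u v with
  | mem y hy =>
    obtain ⟨w, hw, rfl⟩ := hy
    have : u = w + v := toInt_injective (by rw [toInt_add, ← hx, sub_add_cancel])
    rw [this]
    simpa using C.add (hC w hw) (C.refl v)
  | zero =>
    rw [toInt_injective (sub_eq_zero.1 hx)]
    exact C.refl v
  | neg y _ ih =>
    refine C.symm (ih ?_)
    rw [← neg_sub, hx, neg_neg]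
  | add y z _ hz ihy ihz =>
    rw [hW] at hz
    -- The intermediate point `v + z` may have negative entries. Translating by `N • e`, which is
    -- congruent to `0`, brings it into `ℕⁿ`.
    set N : ℕ := ∑ i, (z i).natAbs
    obtain ⟨m, hm⟩ : ∃ m : Fin n →₀ ℕ, toInt m = toInt (N • e + v) + z := by
      refine exists_toInt_eq fun i => ?_
      have h0 : (toInt (N • e + v) + z) i = N * e i + v i + z i := by simp [toInt]
      rw [h0]
      change (0 : ℤ) ≤ _
      by_cases hi : i ∈ sigma L
      · have h1 : (z i).natAbs ≤ N := Finset.single_le_sum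
          (f := fun i => (z i).natAbs) (fun _ _ => Nat.zero_le _) (Finset.mem_univ i)
        have h2 : N ≤ N * e i := Nat.le_mul_of_pos_right _ (he i hi)
        have h3 : (N : ℤ) ≤ N * e i := by exact_mod_cast h2
        omega
      · rw [apply_eq_zero_of_mem_pureSublattice hz hi]
        positivity
    have h1 : C (N • e + u) m := ihy (by
      rw [hm, toInt_add, toInt_add, sub_eq_iff_eq_add.1 hx]
      abel)
    have h2 : C m (N • e + v) := ihz (by rw [hm, add_sub_cancel_left])
    exact rel_of_add_left_of_rel_zero C (s' := 0) (by simpa using hNe N) (C.trans h1 h2)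

variable (k) in
/-- The binomials joining the component of a base point of the fiber `F` to the other
components. -/
def star (F : Fiber L) : Set (MvPolynomial (Fin n) k) :=
  (fun C : GammaVertex k F => mono k F.nonempty.choose - mono k (exists_node_eq C).choose) ''
    (Set.univ \ {node k F F.nonempty.choose})

theorem encard_star_le (F : Fiber L) : (star k F).encard ≤ t k F.cls - 1 := by
  refine (Set.encard_image_le _ _).trans ?_
  rw [Set.encard_sdiff_singleton_of_mem (Set.mem_univ _), Set.encard_univ, t_cls]

theorem mem_star {F : Fiber L} {p : MvPolynomial (Fin n) k} (hp : p ∈ star k F) :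
    ∃ u v, u ∈ F.1 ∧ v ∈ F.1 ∧ p = mono k u - mono k v := by
  obtain ⟨C, -, rfl⟩ := hp
  exact ⟨_, _, F.nonempty.choose_spec, (exists_node_eq C).choose_spec.1, rfl⟩

theorem exists_mem_star_or (F : Fiber L) (C : GammaVertex k F) :
    ∃ v ∈ F.1, node k F v = C ∧
      (mono k F.nonempty.choose - mono k v ∈ star k F ∨ v = F.nonempty.choose) := by
  by_cases hC : C = node k F F.nonempty.choose
  · exact ⟨_, F.nonempty.choose_spec, hC.symm, Or.inr rfl⟩
  · exact ⟨_, (exists_node_eq C).choose_spec.1, (exists_node_eq C).choose_spec.2,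
      Or.inl ⟨C, ⟨trivial, hC⟩, rfl⟩⟩

/-- All binomials of the class of `F` lie in an ideal containing the star of `F` and all binomials
of smaller classes. -/
theorem mem_of_star_subset {J : Ideal (MvPolynomial (Fin n) k)} {F : Fiber L}
    (hF : F.cls ≠ oneClass L) (hJ : idealLT k F.cls ≤ J) (hstar : star k F ⊆ J)
    {u v : Fin n →₀ ℕ} (huv : toInt u - toInt v ∈ L) (hu : clsOf L u = F.cls) :
    mono k u - mono k v ∈ J := by
  have hbase : ∀ {w}, w ∈ F.1 → idealCon J F.nonempty.choose w := fun {w} hw => by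
    obtain ⟨v, hv, hvC, h⟩ := exists_mem_star_or F (node k F w)
    have h1 : idealCon J v w := hJ (mem_idealLT_of_node_eq hF hv hw hvC)
    rcases h with h | rfl
    · exact (idealCon J).trans (hstar h) h1
    · exact h1
  obtain ⟨a, b, hab, hau, hav, -, -⟩ := exists_shift_pair huv hu
  have h1 : idealCon J (a + u) (a + v) :=
    (idealCon J).trans ((idealCon J).symm (hbase hau)) (hbase hav)
  -- Since `a + b ∈ L⁺`, the binomial `x^(a+b) - 1` has the class of `1`, below that of `F`; so
  -- translation by `a` can be cancelled modulo `J`.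
  have h2 : idealCon J (b + a) 0 := hJ (mem_idealLT
    (by rw [add_comm, toInt_zero, sub_zero]; exact hab)
    (by rw [add_comm, clsOf_eq_oneClass_of_mem hab]; exact oneClass_lt hF))
  exact rel_of_add_left_of_rel_zero _ h2 h1

variable (k L) in
/-- The number of elements of each class in a Markov basis. -/
def partCard (c : FiberClass L) : ℕ∞ :=
  open Classical in
  -- The truncated subtraction is harmless: there is always at least one component.
  if c = oneClass L then (Module.finrank ℤ (pureSublattice L) : ℕ∞) else t k c - 1

theorem partCard_le_encard_part {T : Set (MvPolynomial (Fin n) k)} (hT : IsBinomialGenSet L T)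
    (c : FiberClass L) : partCard k L c ≤ (part L T c).encard := by
  unfold partCard
  split_ifs with hc
  · rw [hc]
    exact hT.finrank_pureSublattice_le
  · induction c using Quotient.inductionOn with
    | h F => exact tsub_le_iff_right.2 (hT.card_gammaVertex_le F)

theorem clsOf_eq_of_binomial_eq {u v u' v' : Fin n →₀ ℕ} (huv : u ≠ v)
    (h : mono k u - mono k v = mono k u' - mono k v') (hL : toInt u' - toInt v' ∈ L) :
    clsOf L u = clsOf L u' := by
  rcases eq_or_swap_of_binomial_eq huv h with ⟨rfl, rfl⟩ | ⟨rfl, rfl⟩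
  · rfl
  · exact (clsOf_congr hL).symm

-- Nonnegative generators of `L_pure` serve the class of `1`, and the star of one chosen fiber
-- serves each other class. Generation follows by well-founded induction on the class; finiteness is
-- not yet claimed.
variable (k L) in
theorem exists_genSet_encard_part_le : ∃ S : Set (MvPolynomial (Fin n) k),
    IsBinomialGenSet L S ∧ ∀ c, (part L S c).encard ≤ partCard k L c := by
  obtain ⟨W, hWcard, hW⟩ := exists_pure_generators L
  have hWL : ∀ w ∈ W, toInt w ∈ L := fun w hw => by
    have h : toInt w ∈ AddSubgroup.closure (toInt '' W) :=
      AddSubgroup.subset_closure (Set.mem_image_of_mem _ hw)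
    rw [hW] at h
    exact pureSublattice_le L h
  let rep : FiberClass L → Fiber L := Quotient.out
  have hrep : ∀ c, (rep c).cls = c := fun c => Quotient.out_eq c
  let S₁ : Set (MvPolynomial (Fin n) k) := (fun w => mono k w - mono k 0) '' W
  let S : Set (MvPolynomial (Fin n) k) :=
    S₁ ∪ ⋃ (c : FiberClass L) (_ : c ≠ oneClass L), star k (rep c)
  have hS₁ : S₁ ⊆ S := Set.subset_union_left
  have hS₂ : ∀ c ≠ oneClass L, star k (rep c) ⊆ S := fun c hc p hp =>
    Or.inr (Set.mem_iUnion₂.2 ⟨c, hc, hp⟩)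
  have hmem : ∀ p ∈ S, ∃ u v, toInt u - toInt v ∈ L ∧ p = mono k u - mono k v ∧
      ((clsOf L u = oneClass L ∧ p ∈ S₁) ∨
        (clsOf L u ≠ oneClass L ∧ p ∈ star k (rep (clsOf L u)))) := by
    rintro p (⟨w, hw, rfl⟩ | hp)
    · exact ⟨w, 0, by simpa [toInt_zero] using hWL w hw, rfl,
        Or.inl ⟨clsOf_eq_oneClass_of_mem (hWL w hw), w, hw, rfl⟩⟩
    · obtain ⟨c, hc, hp⟩ := Set.mem_iUnion₂.1 hp
      obtain ⟨u, v, hu, hv, rfl⟩ := mem_star hp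
      have hcu : clsOf L u = c := (clsOf_eq_of_mem hu).trans (hrep c)
      refine ⟨u, v, sub_mem_of_mem _ hv hu, rfl, Or.inr ⟨hcu ▸ hc, ?_⟩⟩
      rw [hcu]
      exact hp
  refine ⟨S, ⟨?_, le_antisymm ?_ ?_⟩, fun c => ?_⟩
  · intro p hp
    obtain ⟨u, v, -, rfl, -⟩ := hmem p hp
    exact ⟨u, v, rfl⟩
  · refine Ideal.span_le.2 fun p hp => ?_
    obtain ⟨u, v, h, rfl, -⟩ := hmem p hp
    exact mono_sub_mono_mem_latticeIdeal.2 h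
  · have key : ∀ c : FiberClass L, ∀ u v : Fin n →₀ ℕ, toInt u - toInt v ∈ L → clsOf L u = c →
        mono k u - mono k v ∈ Ideal.span S := by
      intro c
      induction c using WellFoundedLT.induction with
      | ind c ih =>
        intro u v huv hu
        by_cases hc : c = oneClass L
        · rw [hc] at hu
          have hv : clsOf L v = oneClass L := (clsOf_congr huv).symm.trans hu
          refine rel_of_sub_mem_pureSublattice (L := L) (idealCon (Ideal.span S)) hW
            (fun w hw => Ideal.subset_span (hS₁ ⟨w, hw, rfl⟩))
            (mem_pureSublattice_of_support huv fun i hi => ?_)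
          simp [toInt, apply_eq_zero_of_clsOf_eq_oneClass hu hi,
            apply_eq_zero_of_clsOf_eq_oneClass hv hi]
        · refine mem_of_star_subset (F := rep c) (by rwa [hrep]) ?_
            ((hS₂ c hc).trans Ideal.subset_span) huv (hu.trans (hrep c).symm)
          refine Ideal.span_le.2 ?_
          rintro _ ⟨hp, a, b, rfl, hab⟩
          rw [hrep] at hab
          exact ih _ hab a b (mono_sub_mono_mem_latticeIdeal.1 hp) rfl
    refine Ideal.span_le.2 ?_
    rintro _ ⟨u, v, h, rfl⟩
    exact key _ u v h rfl
  · have hpart : ∀ p ∈ part L S c, (c = oneClass L ∧ p ∈ S₁) ∨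
        (c ≠ oneClass L ∧ p ∈ star k (rep c)) := by
      rintro p ⟨hp, u, v, huv, hpe, hc⟩
      obtain ⟨u', v', hL, hpe', h⟩ := hmem p hp
      have := clsOf_eq_of_binomial_eq huv (hpe.symm.trans hpe') hL
      rwa [← this, hc] at h
    unfold partCard
    split_ifs with hc
    · refine le_trans (Set.encard_le_encard fun p hp => ?_)
        ((Set.encard_image_le (fun w => mono k w - mono k 0) W).trans hWcard)
      exact ((hpart p hp).resolve_right fun h => h.1 hc).2
    · have h1 := encard_star_le (k := k) (rep c)
      rw [hrep] at h1
      refine le_trans (Set.encard_le_encard fun p hp => ?_) h1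
      exact ((hpart p hp).resolve_left fun h => hc h.1).2

end Construction

/-! ### Counting -/

section Counting

variable {k : Type*} [Field k] {n : ℕ} {L : AddSubgroup (Fin n → ℤ)}
  {S T : Set (MvPolynomial (Fin n) k)}

theorem part_subset (T : Set (MvPolynomial (Fin n) k)) (c : FiberClass L) : part L T c ⊆ T :=
  fun _ hp => hp.1

theorem part_mono (h : S ⊆ T) (c : FiberClass L) : part L S c ⊆ part L T c :=
  fun _ hp => ⟨h hp.1, hp.2⟩

theorem IsBinomialGenSet.exists_mem_part (hT : IsBinomialGenSet L T) (h0 : 0 ∉ T)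
    {p : MvPolynomial (Fin n) k} (hp : p ∈ T) : ∃ c, p ∈ part L T c := by
  obtain ⟨u, v, rfl⟩ := hT.isBinomial p hp
  have huv : u ≠ v := by
    rintro rfl
    exact h0 (by simpa using hp)
  exact ⟨clsOf L u, hp, u, v, huv, rfl, rfl⟩

theorem IsBinomialGenSet.eq_of_mem_part (hT : IsBinomialGenSet L T)
    {p : MvPolynomial (Fin n) k} {c c' : FiberClass L} (h : p ∈ part L T c)
    (h' : p ∈ part L T c') : c = c' := by
  obtain ⟨hp, u, v, huv, rfl, rfl⟩ := h
  obtain ⟨-, u', v', -, he, rfl⟩ := h'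
  exact clsOf_eq_of_binomial_eq huv he (hT.sub_mem (he ▸ hp))

theorem IsBinomialGenSet.pairwiseDisjoint_part (hT : IsBinomialGenSet L T)
    (C : Set (FiberClass L)) : C.PairwiseDisjoint (part L T) :=
  fun _ _ _ _ hne => Set.disjoint_left.2 fun _ h h' => hne (hT.eq_of_mem_part h h')

variable (L) in
/-- The classes of the fibers of the nonzero elements of `S`. -/
def classes (S : Set (MvPolynomial (Fin n) k)) : Set (FiberClass L) := {c | (part L S c).Nonempty}

theorem IsBinomialGenSet.finite_classes (hS : IsBinomialGenSet L S) (hfin : S.Finite) :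
    (classes L S).Finite := by
  have hex : ∀ c : classes L S, ∃ p : S, p.1 ∈ part L S c := fun c =>
    ⟨⟨_, c.2.choose_spec.1⟩, c.2.choose_spec⟩
  choose f hf using hex
  have : Finite S := hfin
  refine Finite.of_injective f fun c c' h => Subtype.ext ?_
  exact hS.eq_of_mem_part (hf c) (h ▸ hf c')

theorem IsBinomialGenSet.biUnion_part (hS : IsBinomialGenSet L S) (h0 : 0 ∉ S)
    {C : Set (FiberClass L)} (hC : classes L S ⊆ C) : ⋃ c ∈ C, part L S c = S := by
  refine Set.Subset.antisymm (Set.iUnion₂_subset fun c _ => part_subset S c) fun p hp => ?_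
  obtain ⟨c, hc⟩ := hS.exists_mem_part h0 hp
  exact Set.mem_iUnion₂.2 ⟨c, hC ⟨p, hc⟩, hc⟩

variable (k L) in
/-- There is a finite binomial generating set with the least possible number of elements in every
class. -/
theorem exists_finite_genSet : ∃ S : Set (MvPolynomial (Fin n) k), IsBinomialGenSet L S ∧
    S.Finite ∧ 0 ∉ S ∧ ∀ c, (part L S c).encard = partCard k L c := by
  obtain ⟨S₀, hS₀, hcard⟩ := exists_genSet_encard_part_le k L
  -- Passing to a finite generating subset can only lower the count in each class, and the lower
  -- bound forbids any loss.
  obtain ⟨S', hS', hspan⟩ := (Submodule.fg_span_iff_fg_span_finset_subset S₀).1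
    (IsNoetherian.noetherian (Ideal.span S₀))
  have hS : IsBinomialGenSet L ((S' : Set (MvPolynomial (Fin n) k)) \ {0}) :=
    { isBinomial := fun p hp => hS₀.isBinomial p (hS' hp.1)
      span_eq := by
        rw [Ideal.span_sdiff_singleton_zero, ← hS₀.span_eq]
        exact hspan.symm }
  refine ⟨_, hS, S'.finite_toSet.sdiff, fun h => h.2 rfl, fun c => le_antisymm ?_ ?_⟩
  · exact (Set.encard_le_encard (part_mono (Set.sdiff_subset.trans hS') c)).trans (hcard c)
  · exact partCard_le_encard_part hS c

theorem IsMinimalGenSet.isBinomialGenSet (hT : IsMinimalGenSet k L T) : IsBinomialGenSet L T :=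
  ⟨hT.1, hT.2.1⟩

theorem IsMinimalGenSet.zero_notMem (hT : IsMinimalGenSet k L T) : 0 ∉ T := fun h =>
  hT.2.2 (T \ {0}) (Set.sdiff_singleton_ssubset.2 h)
    (by rw [Ideal.span_sdiff_singleton_zero, hT.2.1])

theorem encard_le_encard_biUnion_part (hS : IsBinomialGenSet L S) (hfin : S.Finite) (h0 : 0 ∉ S)
    (hcard : ∀ c, (part L S c).encard = partCard k L c) (hT : IsBinomialGenSet L T) :
    S.encard ≤ (⋃ c ∈ classes L S, part L T c).encard := by
  have hC := hS.finite_classes hfin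
  rw [← congrArg Set.encard (hS.biUnion_part h0 subset_rfl),
    hC.encard_biUnion (hS.pairwiseDisjoint_part _), hC.encard_biUnion (hT.pairwiseDisjoint_part _),
    finsum_mem_eq_finite_toFinset_sum _ hC, finsum_mem_eq_finite_toFinset_sum _ hC]
  exact Finset.sum_le_sum fun c _ => hcard c ▸ partCard_le_encard_part hT c

/-- A generating proper subset would fall below the lower bound in the class of a missing element;
least cardinality follows by adding the bounds over the classes of `S`. -/
theorem isMarkovBasis_of_encard_part_eq (hS : IsBinomialGenSet L S) (hfin : S.Finite)
    (h0 : 0 ∉ S) (hcard : ∀ c, (part L S c).encard = partCard k L c) : IsMarkovBasis k L S := by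
  refine ⟨⟨hS.isBinomial, hS.span_eq, fun T hTS hT => ?_⟩, fun T hT => ?_⟩
  · have hT' : IsBinomialGenSet L T := ⟨fun p hp => hS.isBinomial p (hTS.1 hp), hT⟩
    obtain ⟨p, hpS, hpT⟩ := Set.exists_of_ssubset hTS
    obtain ⟨c, hc⟩ := hS.exists_mem_part h0 hpS
    have hss : part L T c ⊂ part L S c :=
      (Set.ssubset_iff_of_subset (part_mono hTS.1 c)).2 ⟨p, hc, fun h => hpT h.1⟩
    have hlt := ((hfin.subset hTS.1).subset (part_subset T c)).encard_lt_encard hss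
    exact (hcard c ▸ hlt).not_ge (partCard_le_encard_part hT' c)
  · exact (encard_le_encard_biUnion_part hS hfin h0 hcard hT.isBinomialGenSet).trans
      (Set.encard_le_encard (Set.iUnion₂_subset fun c _ => part_subset T c))

/-- If a Markov basis `T` had an element of a class not met by `S`, its elements in the classes of
`S` would already number at least `|S| ≥ |T|`, too many for a finite set with one more element. -/
theorem markovClasses_eq_classes (hS : IsBinomialGenSet L S) (hfin : S.Finite)
    (h0 : 0 ∉ S) (hcard : ∀ c, (part L S c).encard = partCard k L c) :
    markovClasses k L = classes L S := by
  have hmarkov := isMarkovBasis_of_encard_part_eq hS hfin h0 hcard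
  ext c
  constructor
  · rintro ⟨F, ⟨T, hT, u, v, hp, hF⟩, rfl⟩
    have hTgen := hT.1.isBinomialGenSet
    have huv : u ≠ v := by
      rintro rfl
      exact hT.1.zero_notMem (by simpa using hp)
    by_contra hc
    have hsub : ⋃ c ∈ classes L S, part L T c ⊆ T \ {mono k u - mono k v} := by
      refine Set.iUnion₂_subset fun c' hc' q hq => ⟨hq.1, ?_⟩
      rintro rfl
      have : c' = F.cls := hTgen.eq_of_mem_part hq ⟨hp, u, v, huv, rfl, hF.symm⟩
      exact hc (this ▸ hc')
    have hTS : T.encard ≤ S.encard := hT.2 S hmarkov.1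
    have hTfin : T.Finite := Set.encard_lt_top_iff.1 (hTS.trans_lt hfin.encard_lt_top)
    have hlt : (T \ {mono k u - mono k v}).encard < T.encard :=
      (hTfin.subset Set.sdiff_subset).encard_lt_encard (Set.sdiff_singleton_ssubset.2 hp)
    have hle := (encard_le_encard_biUnion_part hS hfin h0 hcard hTgen).trans
      (Set.encard_le_encard hsub)
    exact ((hTS.trans hle).trans_lt hlt).false
  · rintro ⟨p, hp, u, v, huv, rfl, rfl⟩
    exact ⟨Fiber.of L u, ⟨S, hmarkov, u, v, hp, rfl⟩, rfl⟩

theorem IsMarkovBasis.coe_mu (hS : IsMarkovBasis k L S) (hfin : S.Finite) :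
    (mu k L : ℕ∞) = S.encard := by
  obtain ⟨m, hm⟩ := hfin.exists_encard_eq_coe
  have hmem : m ∈ {m : ℕ | ∃ S : Set (MvPolynomial (Fin n) k),
      IsMinimalGenSet k L S ∧ S.encard = m} := ⟨S, hS.1, hm⟩
  rw [hm, Nat.cast_inj]
  refine le_antisymm (Nat.sInf_le hmem) (le_csInf ⟨m, hmem⟩ ?_)
  rintro m' ⟨T, hT, hm'⟩
  have := hS.2 T hT
  rw [hm, hm'] at this
  exact_mod_cast this

end Counting

end

end LatticeIdeal

theorem theorem4p10 (k : Type*) [Field k] (n : ℕ) (L : AddSubgroup (Fin n → ℤ)) :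
    (∃ S : Set (MvPolynomial (Fin n) k), LatticeIdeal.IsMarkovBasis k L S ∧ S.Finite) ∧
    (LatticeIdeal.markovClasses k L).Finite ∧
    (LatticeIdeal.mu k L : ℕ∞) =
      (Module.finrank ℤ (LatticeIdeal.pureSublattice L) : ℕ∞) +
        ∑ᶠ c ∈ LatticeIdeal.markovClasses k L \ {LatticeIdeal.oneClass L},
          (LatticeIdeal.t k c - 1) := by
  open LatticeIdeal in
  obtain ⟨S, hS, hfin, h0, hcard⟩ := exists_finite_genSet k L
  have hmarkov := isMarkovBasis_of_encard_part_eq hS hfin h0 hcard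
  have hC := hS.finite_classes hfin
  rw [markovClasses_eq_classes hS hfin h0 hcard]
  refine ⟨⟨S, hmarkov, hfin⟩, hC, ?_⟩
  set D := classes L S \ {oneClass L}
  have hD : D.Finite := hC.sdiff
  -- The class of `1` need not be met by `S`; including it is harmless, since its part is then empty
  -- and the rank is zero.
  have hsub : classes L S ⊆ insert (oneClass L) D := by
    rw [Set.insert_sdiff_singleton]
    exact Set.subset_insert _ _
  rw [hmarkov.coe_mu hfin, ← congrArg Set.encard (hS.biUnion_part h0 hsub),
    (hD.insert _).encard_biUnion (hS.pairwiseDisjoint_part _),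
    finsum_mem_insert _ (fun h => h.2 rfl) hD, hcard, partCard, if_pos rfl]
  congr 1
  refine finsum_mem_congr rfl fun c hc => ?_
  rw [hcard, partCard]
  exact if_neg hc.2
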